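/- Let $k,n$ be positive integers, $\Delta=\{\zeta\in\mathbb C:|\zeta|<1\}$, and let $\Omega\subset\mathbb C^n$ be a strictly convex domain (an open nonempty convex set whose boundary contains no nondegenerate segment; $\Omega$ need not be bounded) with smooth boundary $b\Omega$ and a $C^\infty$ defining function $\rho$ near $b\Omega$ ($\Omega=\{\rho<0\}$ and $d\rho\ne0$ on $b\Omega$); write $\partial\rho=(\partial\rho/\partial z_1,\dots,\partial\rho/\partial z_n)$. For $f$ holomorphic near $0$, let $J^k(f)=(f'(0),\dots,f^{(k)}(0))\in(\mathbb C^n)^k$, and let $\lambda\cdot(\xi_1,\dots,\xi_k)=(\lambda\xi_1,\lambda^2\xi_2,\dots,\lambda^k\xi_k)$. Let $f:\overline\Delta\to\mathbb C^n$ be a non-constant $k$-stationary disc attached to $b\Omega$, that is: $f$ is continuous on $\overline\Delta$ and holomorphic on $\Delta$, $f(b\Delta)\subset b\Omega$, and there is a continuous function $c:b\Delta\to(0,\infty)$ such that the map $\zeta\mapsto\zeta^k c(\zeta)\,\partial\rho(f(\zeta))$ on $b\Delta$ extends to a map that is continuous on $\overline\Delta$ and holomorphic on $\Delta$. Then $f$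 is locally extremal for the Kobayashi $k$-metric of $\Omega$: one has $f(\Delta)\subset\Omega$, and there is a neighborhood $\mathcal U$ of $f$, for the topology of uniform convergence on compact subsets of $\Delta$, in the space of holomorphic maps $\Delta\to\Omega$ such that, if $g\in\mathcal U$ satisfies $g(0)=f(0)$ and $J^k(g)=\lambda\cdot J^k(f)$ for some $\lambda>0$, then $\lambda\le1$. -/

import Mathlib

open Set Metric
open scoped ContDiff

/-- The space `ℂⁿ` with its Hermitian (Euclidean) norm. -/
abbrev Cn (n : ℕ) : Type := EuclideanSpace ℂ (Fin n)

/-- The open unit disc `Δ` in `ℂ`. -/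
abbrev unitDisc : Set ℂ := ball (0 : ℂ) 1

/-- The unit circle `bΔ` in `ℂ`. -/
abbrev unitCircle : Set ℂ := sphere (0 : ℂ) 1

/-- Strictly convex domains: open, nonempty, convex, and the closure is strictly convex, that is,
the boundary contains no nondegenerate segment. (Boundedness is not required.) -/
structure IsStrictlyConvexDomain {n : ℕ} (Ω : Set (Cn n)) : Prop where
  isOpen : IsOpen Ω
  nonempty : Ω.Nonempty
  convex : Convex ℝ Ω
  strictConvex_closure : StrictConvex ℝ (closure Ω)

/-- `ρ` is a smooth defining function of `Ω`: it is real-valued and `C^∞` on an open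
neighborhood `U` of the boundary of `Ω`, one has `Ω = {ρ < 0}` in `U`, and `dρ` vanishes nowhere
on the boundary. (A function defined on all of `ℂⁿ` is the case `U = univ`.) -/
def IsSmoothDefiningFunction {n : ℕ} (Ω : Set (Cn n)) (ρ : Cn n → ℝ) : Prop :=
  ∃ U : Set (Cn n), IsOpen U ∧ frontier Ω ⊆ U ∧ ContDiffOn ℝ ∞ ρ U ∧
    (∀ z ∈ U, z ∈ Ω ↔ ρ z < 0) ∧ ∀ z ∈ frontier Ω, fderiv ℝ ρ z ≠ 0

/-- The vector `∂ρ(z) = (∂ρ/∂z₁, …, ∂ρ/∂zₙ)` of Wirtinger derivatives,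
`∂/∂z_j = (∂/∂x_j - i ∂/∂y_j) / 2`. -/
noncomputable def wirtingerGrad {n : ℕ} (ρ : Cn n → ℝ) (z : Cn n) : Cn n :=
  WithLp.toLp 2 fun j =>
    (1 / 2 : ℂ) *
      ((fderiv ℝ ρ z (EuclideanSpace.single j (1 : ℂ)) : ℂ) -
        Complex.I * (fderiv ℝ ρ z (EuclideanSpace.single j Complex.I) : ℂ))

/-- `f` is a `k`-stationary disc attached to `bΩ`, where `ρ` is a defining function of `Ω`:
`f` is holomorphic on `Δ` and continuous on its closure, it maps `bΔ` into `bΩ`, and for some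
continuous `c : bΔ → (0, ∞)` the map `ζ ↦ ζ^k c(ζ) ∂ρ(f(ζ))` on `bΔ` is the boundary value of a map
`F` that is holomorphic on `Δ` and continuous on its closure. -/
structure IsKStationaryDisc {n : ℕ} (Ω : Set (Cn n)) (ρ : Cn n → ℝ) (k : ℕ) (f : ℂ → Cn n) :
    Prop where
  differentiableOn : DifferentiableOn ℂ f unitDisc
  continuousOn : ContinuousOn f (closedBall (0 : ℂ) 1)
  mapsTo : MapsTo f unitCircle (frontier Ω)
  exists_extension : ∃ c : ℂ → ℝ, ContinuousOn c unitCircle ∧ (∀ ζ ∈ unitCircle, 0 < c ζ) ∧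
    ∃ F : ℂ → Cn n, DifferentiableOn ℂ F unitDisc ∧ ContinuousOn F (closedBall (0 : ℂ) 1) ∧
      ∀ ζ ∈ unitCircle, F ζ = (ζ ^ k * (c ζ : ℂ)) • wirtingerGrad ρ (f ζ)

/-- The coordinates `(f'(0), …, f^(k)(0))` of the `k`-jet at `0` of a map `f` (the entry of index
`ℓ` is the derivative of order `ℓ + 1`). -/
noncomputable def kJet {n : ℕ} (k : ℕ) (f : ℂ → Cn n) : Fin k → Cn n :=
  fun ℓ => iteratedDeriv ((ℓ : ℕ) + 1) f 0

/-- The action `t · (ξ₁, …, ξ_k) = (t ξ₁, t² ξ₂, …, t^k ξ_k)` of complex numbers on `k`-jets. -/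
def jetScale {n k : ℕ} (t : ℂ) (ξ : Fin k → Cn n) : Fin k → Cn n :=
  fun ℓ => t ^ ((ℓ : ℕ) + 1) • ξ ℓ

/-- `f` is a locally extremal disc for the Kobayashi `k`-metric of `Ω` (for the pair consisting of
its center `f(0)` and its `k`-jet): `f` is a holomorphic map from `Δ` to `Ω`, and all `g` in some
neighborhood of `f`, for uniform convergence on compact subsets of `Δ`, among the
holomorphic maps from `Δ` to `Ω`, with the same center and with `k`-jet equal to `t` times that
of `f` for some `t > 0`, have `t ≤ 1`. -/
structure IsLocallyExtremalDisc {n : ℕ} (Ω : Set (Cn n)) (k : ℕ) (f : ℂ → Cn n) : Prop where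
  differentiableOn : DifferentiableOn ℂ f unitDisc
  mapsTo : MapsTo f unitDisc Ω
  exists_nhds : ∃ K : Set ℂ, IsCompact K ∧ K ⊆ unitDisc ∧ ∃ ε : ℝ, 0 < ε ∧
    ∀ g : ℂ → Cn n, DifferentiableOn ℂ g unitDisc → MapsTo g unitDisc Ω →
      (∀ ζ ∈ K, ‖g ζ - f ζ‖ < ε) → g 0 = f 0 →
        ∀ t : ℝ, 0 < t → kJet k g = jetScale (t : ℂ) (kJet k f) → t ≤ 1

/-! Suppose `t > 1`. The disc `ζ ↦ g (ζ / t)` has the same center and `k`-jet as `f`, so their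
difference `u` vanishes to order `k + 1` at `0`, and `h = (∑ j, u j * F j) / ζ ^ k` is holomorphic
with `h 0 = 0`. On the circle, `h` is `c > 0` times the pairing of `u` with `∂ρ(f)`; the supporting
hyperplane at `f ζ` makes its real part positive (`fderiv_sub_neg`), against the maximum principle
(`exists_re_nonpos`). -/

/-- The real differential of `ρ` is twice the real part of the pairing with `∂ρ`. -/
theorem fderiv_eq_two_mul_re_sum_wirtingerGrad {n : ℕ} (ρ : Cn n → ℝ) (z v : Cn n) :
    fderiv ℝ ρ z v = 2 * (∑ j, v j * wirtingerGrad ρ z j).re := by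
  have hv : v = ∑ j, ((v j).re • EuclideanSpace.single j (1 : ℂ) +
      (v j).im • EuclideanSpace.single j Complex.I) := by
    ext i
    simp only [WithLp.ofLp_sum, Finset.sum_apply, PiLp.add_apply, PiLp.smul_apply,
      PiLp.single_apply]
    rw [Finset.sum_eq_single i (fun j _ hj => by simp [hj.symm]) (by simp)]
    simp [Complex.re_add_im]
  conv_lhs => rw [hv]
  simp only [map_sum, map_add, map_smul, Complex.re_sum, Finset.mul_sum, wirtingerGrad]
  refine Finset.sum_congr rfl fun j _ => ?_
  simp
  ring

/-- A nonzero continuous linear functional that is nonpositive on `s - p`, for an open set `s`, is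
negative there. -/
theorem ContinuousLinearMap.neg_of_nonpos_of_isOpen {E : Type*} [NormedAddCommGroup E]
    [NormedSpace ℝ E] {L : E →L[ℝ] ℝ} (hL : L ≠ 0) {s : Set E} (hs : IsOpen s) {p : E}
    (h : ∀ w ∈ s, L (w - p) ≤ 0) {w : E} (hw : w ∈ s) : L (w - p) < 0 := by
  refine lt_of_le_of_ne (h w hw) fun h0 => hL ?_
  have hmax : IsLocalMax L w := by
    filter_upwards [hs.mem_nhds hw] with x hx
    have := h x hx
    rw [map_sub] at this h0
    linarith
  simpa using hmax.hasFDerivAt_eq_zero L.hasFDerivAt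

/-- The differential of a defining function at a boundary point of an open convex set defines
a strictly supporting hyperplane. -/
theorem IsSmoothDefiningFunction.fderiv_sub_neg {n : ℕ} {Ω : Set (Cn n)} {ρ : Cn n → ℝ}
    (hρ : IsSmoothDefiningFunction Ω ρ) (ho : IsOpen Ω) (hc : Convex ℝ Ω) {p w : Cn n}
    (hp : p ∈ frontier Ω) (hw : w ∈ Ω) : fderiv ℝ ρ p (w - p) < 0 := by
  obtain ⟨U, hU, hsub, hsm, hneg, hne⟩ := hρ
  have hpΩ : p ∉ Ω := by
    rw [ho.frontier_eq] at hp
    exact hp.2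
  have hp0 : 0 ≤ ρ p := not_lt.1 fun h => hpΩ ((hneg p (hsub hp)).2 h)
  have hd : DifferentiableAt ℝ ρ p :=
    ((hsm.contDiffAt (hU.mem_nhds (hsub hp))).differentiableAt (by simp))
  refine ContinuousLinearMap.neg_of_nonpos_of_isOpen (hne p hp) ho (fun x hx => ?_) hw
  have hline : HasDerivAt (fun t : ℝ => p + t • (x - p)) (x - p) 0 := by
    simpa using ((hasDerivAt_id (0 : ℝ)).smul_const (x - p)).const_add p
  have hcomp : HasDerivAt (fun t : ℝ => ρ (p + t • (x - p))) (fderiv ℝ ρ p (x - p)) 0 :=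
    HasFDerivAt.comp_hasDerivAt (0 : ℝ) (l := ρ) (by simpa using hd.hasFDerivAt) hline
  have hlim := hcomp.tendsto_slope_zero_right
  refine le_of_tendsto hlim ?_
  have hmemU : ∀ᶠ t : ℝ in nhdsWithin 0 (Ioi 0), p + t • (x - p) ∈ U := by
    refine (hline.continuousAt.eventually (hU.mem_nhds ?_)).filter_mono nhdsWithin_le_nhds
    simpa using hsub hp
  filter_upwards [hmemU, Ioc_mem_nhdsGT (zero_lt_one' ℝ)] with t htU ht
  have hmem : p + t • (x - p) ∈ Ω := interior_subset
    (hc.add_smul_sub_mem_interior' (frontier_subset_closure hp) (by rwa [ho.interior_eq]) ht)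
  have h1 := (hneg _ htU).1 hmem
  simp only [zero_add, zero_smul, add_zero, smul_eq_mul]
  exact mul_nonpos_of_nonneg_of_nonpos (inv_nonneg.2 ht.1.le) (by linarith)

/-- A holomorphic disc attached to the boundary of a strictly convex domain is either constant or
contained in the domain. -/
theorem IsStrictlyConvexDomain.mapsTo_of_nonconstant {n : ℕ} {Ω : Set (Cn n)}
    (hΩ : IsStrictlyConvexDomain Ω) {f : ℂ → Cn n} (hf : DiffContOnCl ℂ f unitDisc)
    (hb : MapsTo f unitCircle (frontier Ω)) (hnc : ∃ ζ ∈ closedBall (0 : ℂ) 1, f ζ ≠ f 0) :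
    MapsTo f unitDisc Ω := by
  intro z hz
  by_contra hzΩ
  obtain ⟨L, hL⟩ := RCLike.geometric_hahn_banach_open_point (𝕜 := ℂ) hΩ.convex hΩ.isOpen hzΩ
  have hLc : ∀ a ∈ closure Ω, (L a).re ≤ (L (f z)).re := fun a ha =>
    closure_minimal (t := {a | (L a).re ≤ (L (f z)).re}) (fun a ha => (hL a ha).le)
      (isClosed_le (Complex.continuous_re.comp L.continuous) continuous_const) ha
  -- The modulus of `exp (L ∘ f)` is the exponential of `Re (L ∘ f)`, so it peaks at the interior
  -- point `z` and is constant. All boundary values then lie on one supporting hyperplane, which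
  -- strict convexity reduces to a point.
  have hE : DiffContOnCl ℂ (fun ζ => Complex.exp (L (f ζ))) unitDisc :=
    (Complex.differentiable_exp.comp L.differentiable).comp_diffContOnCl hf
  have hmax : ∀ ζ ∈ closure unitDisc, ‖Complex.exp (L (f ζ))‖ ≤ ‖Complex.exp (L (f z))‖ :=
    fun ζ hζ => Complex.norm_le_of_forall_mem_frontier_norm_le isBounded_ball hE (fun ξ hξ => by
      rw [frontier_ball _ one_ne_zero] at hξ
      rw [Complex.norm_exp, Complex.norm_exp, Real.exp_le_exp]
      exact hLc _ (frontier_subset_closure (hb hξ))) hζ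
  have heq := Complex.norm_eqOn_closure_of_isPreconnected_of_isMaxOn
    (convex_ball (0 : ℂ) 1).isPreconnected isOpen_ball hE hz
    (fun ζ hζ => hmax ζ (subset_closure hζ))
  have hre : ∀ ζ ∈ unitCircle, (L (f ζ)).re = (L (f z)).re := fun ζ hζ => by
    have := heq (by rw [closure_ball _ one_ne_zero]; exact sphere_subset_closedBall hζ : ζ ∈ _)
    simpa [Complex.norm_exp] using this
  have hconst : ∀ ζ ∈ unitCircle, f ζ = f 1 := fun ζ hζ => by
    by_contra hne
    have h1 : (1 : ℂ) ∈ unitCircle := by simp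
    have hmid := hΩ.strictConvex_closure (frontier_subset_closure (hb hζ))
      (frontier_subset_closure (hb h1)) hne (half_pos one_pos) (half_pos one_pos) (add_halves 1)
    rw [hΩ.convex.interior_closure_eq_interior_of_nonempty_interior
      (by rw [hΩ.isOpen.interior_eq]; exact hΩ.nonempty), hΩ.isOpen.interior_eq] at hmid
    have := hL _ hmid
    rw [map_add, ContinuousLinearMap.map_smul_of_tower, ContinuousLinearMap.map_smul_of_tower] at this
    simp only [RCLike.re_eq_complex_re, Complex.add_re, Complex.real_smul, Complex.re_ofReal_mul,
      hre ζ hζ, hre 1 h1] at this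
    linarith
  have hall := Complex.eqOn_closure_of_eqOn_frontier isBounded_ball hf
    (diffContOnCl_const (c := f 1)) (fun ζ hζ => by
      rw [frontier_ball _ one_ne_zero] at hζ
      exact hconst ζ hζ)
  rw [closure_ball _ one_ne_zero] at hall
  obtain ⟨ζ, hζ, hne⟩ := hnc
  exact hne ((hall hζ).trans (hall (by simp)).symm)

theorem iteratedDeriv_comp_const_mul_eq_smul {E : Type*} [NormedAddCommGroup E] [NormedSpace ℂ E]
    (m : ℕ) (f : ℂ → E) (c : ℂ) :
    iteratedDeriv m (fun x => f (c * x)) = fun x => c ^ m • iteratedDeriv m f (c * x) := by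
  induction m with
  | zero => simp
  | succ m ih =>
    funext x
    rw [iteratedDeriv_succ, ih, iteratedDeriv_succ]
    simp only [deriv_fun_const_smul_field, deriv_comp_mul_left, smul_smul, pow_succ]

/-- A holomorphic function on the disc that vanishes at the center has nonpositive real part
somewhere on the circle. -/
theorem DiffContOnCl.exists_re_nonpos {h : ℂ → ℂ} (hh : DiffContOnCl ℂ h unitDisc)
    (h0 : h 0 = 0) : ∃ ζ ∈ unitCircle, (h ζ).re ≤ 0 := by
  have hE : DiffContOnCl ℂ (fun ζ => Complex.exp (-h ζ)) unitDisc :=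
    Complex.differentiable_exp.comp_diffContOnCl hh.neg
  obtain ⟨ζ, hζ, hmax⟩ := Complex.exists_mem_frontier_isMaxOn_norm isBounded_ball
    ⟨0, mem_ball_self one_pos⟩ hE
  rw [frontier_ball _ one_ne_zero] at hζ
  refine ⟨ζ, hζ, ?_⟩
  have := hmax (subset_closure (mem_ball_self one_pos) : (0 : ℂ) ∈ closure unitDisc)
  simpa [h0, Complex.norm_exp] using this

/-- If `u` vanishes to order greater than `k` at `0`, then the pairing of `u` and `F` divided by
`ζ ^ k` is holomorphic. -/
theorem diffContOnCl_sum_mul_div_pow {n k : ℕ} {u F : ℂ → Cn n}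
    (hu : DiffContOnCl ℂ u unitDisc) (hF : DiffContOnCl ℂ F unitDisc)
    (h0 : ∀ i < k + 1, iteratedDeriv i u 0 = 0) :
    DiffContOnCl ℂ (fun ζ => (∑ j, u ζ j * F ζ j) / ζ ^ k) unitDisc := by
  have hmem : unitDisc ∈ nhds (0 : ℂ) := ball_mem_nhds _ one_pos
  have hua : AnalyticAt ℂ u 0 := hu.differentiableOn.analyticAt hmem
  have hcoord : ∀ j : Fin n, Differentiable ℂ (fun v : Cn n => v j) := fun j => by fun_prop
  have hG : DiffContOnCl ℂ (fun ζ => ∑ j, u ζ j * F ζ j) unitDisc := by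
    refine ⟨?_, ?_⟩
    · exact DifferentiableOn.fun_sum fun j _ =>
        ((hcoord j).comp_diffContOnCl hu).differentiableOn.mul
          ((hcoord j).comp_diffContOnCl hF).differentiableOn
    · exact continuousOn_finsetSum _ fun j _ =>
        ((hcoord j).comp_diffContOnCl hu).continuousOn.mul
          ((hcoord j).comp_diffContOnCl hF).continuousOn
  obtain ⟨q, hq, hqe⟩ := (natCast_le_analyticOrderAt hua).1
    ((natCast_le_analyticOrderAt_iff_iteratedDeriv_eq_zero hua).2 h0)
  -- Order `k + 1` leaves a spare factor `ζ`, so the limit at `0` is `0`, which is also the value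
  -- Lean gives the quotient there.
  have heq : (fun ζ => (∑ j, u ζ j * F ζ j) / ζ ^ k) =ᶠ[nhds 0]
      fun ζ => ζ * ∑ j, q ζ j * F ζ j := by
    filter_upwards [hqe] with ζ hζ
    have hs : ∑ j, u ζ j * F ζ j = ζ ^ k * (ζ * ∑ j, q ζ j * F ζ j) := by
      simp only [hζ, sub_zero, PiLp.smul_apply, smul_eq_mul, Finset.mul_sum]
      refine Finset.sum_congr rfl fun j _ => ?_
      ring
    rw [hs]
    rcases eq_or_ne ζ 0 with rfl | hne
    · simp
    · rw [mul_div_cancel_left₀ _ (pow_ne_zero _ hne)]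
  have hc0 : ContinuousAt (fun ζ => (∑ j, u ζ j * F ζ j) / ζ ^ k) 0 := by
    refine ContinuousAt.congr ?_ heq.symm
    have hFc : ContinuousAt F 0 := hF.differentiableOn.continuousOn.continuousAt hmem
    have hqc : ContinuousAt q 0 := hq.continuousAt
    fun_prop
  refine ⟨(Complex.differentiableOn_compl_singleton_and_continuousAt_iff hmem).1 ⟨?_, hc0⟩, ?_⟩
  · exact (hG.differentiableOn.mono sdiff_subset).div (by fun_prop)
      fun ζ hζ => pow_ne_zero _ hζ.2
  · intro ζ hζ
    rcases eq_or_ne ζ 0 with rfl | hne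
    · exact hc0.continuousWithinAt
    · exact (hG.continuousOn ζ hζ).div (by fun_prop) (pow_ne_zero _ hne)

theorem theorem3 {n : ℕ} (Ω : Set (Cn n)) (hΩ : IsStrictlyConvexDomain Ω)
    (ρ : Cn n → ℝ) (hρ : IsSmoothDefiningFunction Ω ρ) (k : ℕ) (hk : 0 < k)
    (f : ℂ → Cn n) (hf : IsKStationaryDisc Ω ρ k f)
    (hnc : ∃ ζ ∈ closedBall (0 : ℂ) 1, f ζ ≠ f 0) :
    IsLocallyExtremalDisc Ω k f := by
  have hcl : closure unitDisc = closedBall (0 : ℂ) 1 := closure_ball _ one_ne_zero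
  have hfd : DiffContOnCl ℂ f unitDisc := ⟨hf.differentiableOn, hcl ▸ hf.continuousOn⟩
  -- With `K = ∅` the neighborhood is the whole space: the extremality proved is global.
  refine ⟨hf.differentiableOn, hΩ.mapsTo_of_nonconstant hfd hf.mapsTo hnc, ∅, isCompact_empty,
    empty_subset _, 1, one_pos, fun g hg hgΩ _ hg0 t ht hjet => ?_⟩
  by_contra! ht1
  obtain ⟨c, -, hcpos, F, hFd, hFc, hF⟩ := hf.exists_extension
  have ht0 : (t : ℂ) ≠ 0 := by exact_mod_cast ht.ne'
  -- Since `t > 1`, the rescaled disc is continuous up to the circle and maps it into `Ω`, whatever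
  -- the boundary behavior of `g`.
  have hscale : MapsTo (fun ζ : ℂ => (t : ℂ)⁻¹ * ζ) (closedBall 0 1) unitDisc := fun ζ hζ => by
    rw [mem_closedBall_zero_iff] at hζ
    rw [mem_ball_zero_iff, norm_mul, norm_inv, Complex.norm_real, Real.norm_of_nonneg ht.le]
    calc t⁻¹ * ‖ζ‖ ≤ t⁻¹ * 1 := by gcongr
      _ < 1 := by rw [mul_one]; exact inv_lt_one_of_one_lt₀ ht1
  have hgd : DiffContOnCl ℂ (fun ζ => g ((t : ℂ)⁻¹ * ζ)) unitDisc :=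
    ⟨hg.comp (by fun_prop) (hscale.mono_left ball_subset_closedBall),
      hcl ▸ hg.continuousOn.comp (by fun_prop) hscale⟩
  have hmem : unitDisc ∈ nhds (0 : ℂ) := ball_mem_nhds _ one_pos
  have hvanish : ∀ i < k + 1,
      iteratedDeriv i (f - fun ζ => g ((t : ℂ)⁻¹ * ζ)) 0 = 0 := fun i hi => by
    rw [iteratedDeriv_sub (hfd.differentiableOn.analyticAt hmem).contDiffAt
      (hgd.differentiableOn.analyticAt hmem).contDiffAt, iteratedDeriv_comp_const_mul_eq_smul,
      sub_eq_zero]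
    rcases i with _ | i
    · simp [hg0]
    · have hi' := congrFun hjet ⟨i, by omega⟩
      simp only [kJet, jetScale] at hi'
      simp only [mul_zero, hi', smul_smul, ← mul_pow, inv_mul_cancel₀ ht0, one_pow, one_smul]
  obtain ⟨ζ, hζ, hre⟩ := (diffContOnCl_sum_mul_div_pow (hfd.sub hgd) ⟨hFd, hcl ▸ hFc⟩
    hvanish).exists_re_nonpos (by simp [hk.ne'])
  have hζ0 : ζ ≠ 0 := ne_of_mem_sphere hζ one_ne_zero
  set w := g ((t : ℂ)⁻¹ * ζ) with hw
  have hneg := hρ.fderiv_sub_neg hΩ.isOpen hΩ.convex (hf.mapsTo hζ)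
    (hgΩ (hscale (sphere_subset_closedBall hζ)))
  rw [← neg_sub, map_neg, fderiv_eq_two_mul_re_sum_wirtingerGrad] at hneg
  have hval : (∑ j, (f - fun ζ => g ((t : ℂ)⁻¹ * ζ)) ζ j * F ζ j) / ζ ^ k =
      (c ζ : ℂ) * ∑ j, (f ζ - w) j * wirtingerGrad ρ (f ζ) j := by
    rw [div_eq_iff (pow_ne_zero _ hζ0), hF ζ hζ, Finset.mul_sum, Finset.sum_mul]
    refine Finset.sum_congr rfl fun j _ => ?_
    simp only [Pi.sub_apply, PiLp.smul_apply, smul_eq_mul, ← hw]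
    ring
  rw [hval, Complex.re_ofReal_mul] at hre
  have := hcpos ζ hζ
  have : 0 < c ζ * (∑ j, (f ζ - w) j * wirtingerGrad ρ (f ζ) j).re :=
    mul_pos this (by linarith)
  linarith
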